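/- Bradley–Terry model. Let $T\ge 1$ be a fixed integer, let $p_n\in[0,1]$ with $np_n>1$ for all sufficiently large $n$, and for each $n$ let $\mathbf u=\mathbf u^{(n)}\in\mathbb R^n$ be a (deterministic) score vector with $u_1=0$ and dynamic range $M_n=\max_{i,j\in[n]}|u_i-u_j|$. Put $\Phi(y)=e^y/(1+e^y)$, $f(1;y)=\Phi(y)$ and $f(-1;y)=1-\Phi(y)$. All random variables live on one probability space. For each $n$, the pairs $i<j$ in $[n]$ are compared $n_{ij}\sim \mathrm{Bin}(T,p_n)$ times, and the outcomes $X_{ij}^{(t)}\in\{-1,1\}$ have mass function $f(\cdot\,;u_i-u_j)$; for each $n$, all the $n_{ij}$ and all the $X_{ij}^{(t)}$ ($1\le t\le T$, observed only for $t\le n_{ij}$) are mutually independent; nothing is assumed about the dependence between different $n$. The maximum likelihood estimator $\hat{\mathbf u}=\hat{\mathbf u}^{(n)}$ is a maximizer over $\{\mathbf v\in\mathbb R^n: v_1=0\}$ of $$l(\mathbf v)=\sum_{1\le i<j\le n}\ \sum_{t=1}^{n_{ij}}\log f\big(X_{ij}^{(t)};v_i-v_j\big).$$ Suppose that $$\Delta_n=e^{2M_n}\sqrt{\frac{\log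 n}{np_n}}\;\frac{\log n}{\log (np_n)}\longrightarrow 0\qquad(n\to\infty).$$ Then $\hat{\mathbf u}$ is a uniformly consistent estimator of $\mathbf u$, in the following sense. 1. There is a constant $C>0$, independent of $n$, such that for all sufficiently large $n$, with probability at least $1-14n^{-2}$, $\hat{\mathbf u}$ exists, is unique and satisfies $\|\hat{\mathbf u}-\mathbf u\|_\infty\le C\Delta_n$. 2. Almost surely, $\hat{\mathbf u}$ exists and is unique for all but finitely many $n$, and $\|\hat{\mathbf u}-\mathbf u\|_\infty\to 0$. -/

import Mathlib

open MeasureTheory ProbabilityTheory Filter Topology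

noncomputable section

namespace BradleyTerry

/-- The logistic link `Φ(y) = e^y / (1 + e^y)`. -/
def link (y : ℝ) : ℝ := Real.exp y / (1 + Real.exp y)

/-- The mass function `f(x; y)` on the outcome set `A = {-1, 1}`, which is the type `ℤˣ`:
`f(1; y) = Φ(y)` and `f(-1; y) = 1 - Φ(y)`. -/
def mass (x : ℤˣ) (y : ℝ) : ℝ := if x = 1 then link y else 1 - link y

/-- The unordered pairs of distinct subjects, listed as `(i, j)` with `i < j`. -/
abbrev Pair (n : ℕ) : Type := {e : Fin n × Fin n // e.1 < e.2}

/-- The dynamic range `max_{i,j} |u_i - u_j|` of a score vector. -/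
def dynamicRange {n : ℕ} (u : Fin n → ℝ) : ℝ := ⨆ e : Fin n × Fin n, |u e.1 - u e.2|

/-- Comparison data on `n` subjects in the Bradley-Terry model with true scores `u`.
For a pair `e = (i, j)`, `i < j`, the number of observed comparisons `N e` is `Bin(T, p)`, and
`X e t` is the outcome of the comparison number `t` (observed only when `t < N e`), equal to `1`
if `i` defeats `j` and to `-1` otherwise, with mass function `f(·; u_i - u_j)`.
The last three fields together say that all the `N e` and `X e t` are mutually independent. -/
structure IsSample {Ω : Type*} [MeasurableSpace Ω] (μ : Measure Ω) {n : ℕ} (T : ℕ) (p : ℝ)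
    (u : Fin n → ℝ) (N : Pair n → Ω → ℕ) (X : Pair n → Fin T → Ω → ℤˣ) : Prop where
  measurable_count : ∀ e, Measurable (N e)
  measurable_outcome : ∀ e t, Measurable (X e t)
  count_law : ∀ e k, μ.real {ω | N e ω = k} = (T.choose k : ℝ) * p ^ k * (1 - p) ^ (T - k)
  outcome_law : ∀ e t x, μ.real {ω | X e t ω = x} = mass x (u e.1.1 - u e.1.2)
  indep_pairs : iIndepFun (fun e ω => (N e ω, fun t => X e t ω)) μ
  indep_count_outcomes : ∀ e, IndepFun (N e) (fun ω t => X e t ω) μ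
  indep_outcomes : ∀ e, iIndepFun (X e) μ

/-- The conditional log-likelihood
`l(v) = ∑_{i<j} ∑_{t ≤ n_ij} log f(X_ij^(t); v_i - v_j)` of observed counts and outcomes. -/
def logLik {n T : ℕ} (N : Pair n → ℕ) (X : Pair n → Fin T → ℤˣ) (v : Fin n → ℝ) : ℝ :=
  ∑ e : Pair n, ∑ t ∈ (Finset.univ : Finset (Fin T)).filter (fun t : Fin T => (t : ℕ) < N e),
    Real.log (mass (X e t) (v e.1.1 - v e.1.2))

/-- The score of the first subject is `0`. -/
def Anchored {n : ℕ} (v : Fin n → ℝ) : Prop := ∀ i : Fin n, (i : ℕ) = 0 → v i = 0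

/-- `v` maximizes the log-likelihood over all vectors of `ℝⁿ` whose first coordinate is `0`. -/
def IsMLE {n T : ℕ} (N : Pair n → ℕ) (X : Pair n → Fin T → ℤˣ) (v : Fin n → ℝ) : Prop :=
  Anchored v ∧ ∀ w : Fin n → ℝ, Anchored w → logLik N X w ≤ logLik N X v

/-- `v` is the unique maximum likelihood estimator. -/
def IsUniqueMLE {n T : ℕ} (N : Pair n → ℕ) (X : Pair n → Fin T → ℤˣ) (v : Fin n → ℝ) : Prop :=
  IsMLE N X v ∧ ∀ w, IsMLE N X w → w = v

/-- `Δ_n = e^{2 M_n} √(log n / (n p_n)) · log n / log (n p_n)`, with `M_n` the dynamic range. -/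
def rate {n : ℕ} (p : ℝ) (u : Fin n → ℝ) : ℝ :=
  Real.exp (2 * dynamicRange u) * Real.sqrt (Real.log n / (n * p)) *
    (Real.log n / Real.log (n * p))

end BradleyTerry

end

namespace BradleyTerry

/-! ### The logistic link and its primitive -/

/-! The log-likelihood is concave in the score differences. Let `D` be the error of a maximizer.
Stationarity in the direction of the indicator of a vertex set `A` says that the flow out of `A`,
where a pair carries its number of comparisons times the increment of the link, equals the noise
summed over `A`, which is at most `β * A.card`.

Let `A` be a superlevel set of `D` and `B` the one a step `g` lower. Every pair leaving `A` carries
nonnegative outward flow, and a pair ending outside `B` carries at least order `e^{-M} g` per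
comparison. If `B` held at most half of the vertices and at most `ρ * A.card` of them, expansion
would give `γ * A.card` comparisons from `A` to the complement of `B`, hence more flow than the
noise allows. So superlevel sets grow by the factor `ρ` per step until they pass one half
(`superlevel_growth`). The same holds from the bottom; after `K` steps with `2 * ρ ^ K > n` the two
majorities meet, which bounds the range of `D` by `2 * (K * g)` (`error_le_of_isMax_cube`). Applied
to a maximizer over a compact cube, this bound places it in the interior; it is then stationary,
hence global, and strict convexity of `softplus` with connectedness gives uniqueness
(`exists_unique_maximizer`).

With `d = n * p`, Chernoff bounds (`IsSample.chernoff`) and a union bound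
(`IsSample.measureReal_not_isGood_le`) supply `β` of order `√(d log n)`, `γ = d / 8` and `ρ = d /
(32 log n)`. This calls for `g` of order `e^M √(log n / d)`, and `ρ ≥ d^{1/4}` allows `K` of order
`log n / log d`, so `K * g` is within the rate. Borel–Cantelli gives the almost sure statement. -/

/-- The primitive `log (1 + e^y)` of the logistic link. -/
noncomputable def softplus (y : ℝ) : ℝ := Real.log (1 + Real.exp y)

lemma one_add_exp_pos (y : ℝ) : 0 < 1 + Real.exp y := by positivity

lemma link_pos (y : ℝ) : 0 < link y := div_pos (Real.exp_pos y) (one_add_exp_pos y)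

lemma one_sub_link (y : ℝ) : 1 - link y = (1 + Real.exp y)⁻¹ := by
  have := one_add_exp_pos y
  unfold link
  field_simp
  ring

lemma link_lt_one (y : ℝ) : link y < 1 := by
  have : 0 < 1 - link y := by
    rw [one_sub_link]
    exact inv_pos.2 (one_add_exp_pos y)
  linarith

lemma log_link (y : ℝ) : Real.log (link y) = y - softplus y := by
  rw [link, Real.log_div (Real.exp_pos y).ne' (one_add_exp_pos y).ne', Real.log_exp, softplus]

lemma log_one_sub_link (y : ℝ) : Real.log (1 - link y) = -softplus y := by
  rw [one_sub_link, Real.log_inv, softplus]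

lemma hasDerivAt_softplus (y : ℝ) : HasDerivAt softplus (link y) y :=
  ((Real.hasDerivAt_exp y).const_add 1).log (one_add_exp_pos y).ne'

lemma link_strictMono : StrictMono link := by
  intro x y hxy
  have h : (1 + Real.exp y)⁻¹ < (1 + Real.exp x)⁻¹ := by
    have := Real.exp_lt_exp.2 hxy
    exact inv_strictAnti₀ (one_add_exp_pos x) (by linarith)
  rw [← one_sub_link, ← one_sub_link] at h
  linarith

lemma strictConvexOn_softplus : StrictConvexOn ℝ Set.univ softplus := by
  refine StrictMonoOn.strictConvexOn_of_deriv convex_univ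
    (fun y _ => (hasDerivAt_softplus y).continuousAt.continuousWithinAt) ?_
  intro x _ y _ hxy
  rw [(hasDerivAt_softplus x).deriv, (hasDerivAt_softplus y).deriv]
  exact link_strictMono hxy

/-- The graph of `softplus` lies strictly above its tangents. -/
lemma softplus_tangent_lt {x y : ℝ} (h : y ≠ x) :
    softplus x + link x * (y - x) < softplus y := by
  rcases h.lt_or_gt with h | h
  · have := strictConvexOn_softplus.slope_lt_of_hasDerivAt (Set.mem_univ y)
      (Set.mem_univ x) h (hasDerivAt_softplus x)
    rw [slope_def_field, div_lt_iff₀ (by linarith)] at this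
    nlinarith
  · have := strictConvexOn_softplus.lt_slope_of_hasDerivAt (Set.mem_univ x)
      (Set.mem_univ y) h (hasDerivAt_softplus x)
    rw [slope_def_field, lt_div_iff₀ (by linarith)] at this
    nlinarith

lemma softplus_tangent_le (x y : ℝ) : softplus x + link x * (y - x) ≤ softplus y := by
  rcases eq_or_ne y x with rfl | h
  · simp
  · exact (softplus_tangent_lt h).le

/-- The slope of the link on `[x, x + g]` is at least `e^{-M-1} / 4` when `|x| ≤ M` and `g ≤ 1`. -/
lemma link_add_sub_ge {x M g : ℝ} (hx : |x| ≤ M) (hg0 : 0 ≤ g) (hg1 : g ≤ 1) :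
    Real.exp (-M - 1) / 4 * g ≤ link (x + g) - link x := by
  obtain ⟨h1, h2⟩ := abs_le.1 hx
  have e1 : Real.exp x ≤ Real.exp M := Real.exp_le_exp.2 h2
  have e2 : Real.exp (-x) ≤ Real.exp M := Real.exp_le_exp.2 (by linarith)
  have e3 : Real.exp g ≤ Real.exp 1 := Real.exp_le_exp.2 hg1
  have e4 : g ≤ Real.exp g - 1 := by linarith [Real.add_one_le_exp g]
  have e5 : 1 ≤ Real.exp M := Real.one_le_exp ((abs_nonneg x).trans hx)
  have e6 : 1 ≤ Real.exp 1 := Real.one_le_exp zero_le_one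
  have hxx : Real.exp x * Real.exp (-x) = 1 := by rw [← Real.exp_add]; simp
  have px := Real.exp_pos x
  have pg := Real.exp_pos g
  have key : link (x + g) - link x =
      (Real.exp g - 1) / ((1 + Real.exp (-x)) * (1 + Real.exp x * Real.exp g)) := by
    unfold link
    rw [Real.exp_add, Real.exp_neg]
    field_simp
    ring
  rw [key, le_div_iff₀ (by positivity)]
  -- The product expands into four terms, each at most `e^M * e`.
  have h3 : (1 + Real.exp (-x)) * (1 + Real.exp x * Real.exp g) ≤ 4 * (Real.exp M * Real.exp 1) := by
    have : (1 + Real.exp (-x)) * (1 + Real.exp x * Real.exp g)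
      = 1 + Real.exp (-x) + Real.exp x * Real.exp g + Real.exp g := by linear_combination Real.exp g * hxx
    rw [this]
    have a1 : Real.exp x * Real.exp g ≤ Real.exp M * Real.exp 1 := by gcongr
    have a2 : Real.exp M ≤ Real.exp M * Real.exp 1 := le_mul_of_one_le_right (by positivity) e6
    have a3 : Real.exp 1 ≤ Real.exp M * Real.exp 1 := le_mul_of_one_le_left (by positivity) e5
    linarith
  have h4 : Real.exp (-M - 1) * (Real.exp M * Real.exp 1) = 1 := by
    rw [← Real.exp_add, ← Real.exp_add]; simp
  calc Real.exp (-M - 1) / 4 * g * ((1 + Real.exp (-x)) * (1 + Real.exp x * Real.exp g))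
      ≤ Real.exp (-M - 1) / 4 * g * (4 * (Real.exp M * Real.exp 1)) := by gcongr
    _ = g := by linear_combination g * h4
    _ ≤ _ := e4

/-! ### Edge differences and the objective -/

/-- The difference of a vertex function along the pair `e`. -/
def gap {n : ℕ} (v : Fin n → ℝ) (e : Pair n) : ℝ := v e.1.1 - v e.1.2

/-- The indicator of a set of vertices. -/
noncomputable def ind {n : ℕ} (A : Finset (Fin n)) (i : Fin n) : ℝ := if i ∈ A then 1 else 0

/-- The pairs joining `A` to the complement of `B`. -/
noncomputable def cross {n : ℕ} (A B : Finset (Fin n)) : Finset (Pair n) :=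
  Finset.univ.filter fun e => (e.1.1 ∈ A ∧ e.1.2 ∉ B) ∨ (e.1.2 ∈ A ∧ e.1.1 ∉ B)

/-- The log-likelihood in exponential family form, with numbers of wins `Y` and of comparisons
`m`. -/
noncomputable def objective {n : ℕ} (Y m : Pair n → ℝ) (v : Fin n → ℝ) : ℝ :=
  ∑ e, (Y e * gap v e - m e * softplus (gap v e))

/-- The derivative of `objective` at `v` in the direction `d`. -/
noncomputable def slopeAlong {n : ℕ} (Y m : Pair n → ℝ) (v d : Fin n → ℝ) : ℝ :=
  ∑ e, gap d e * (Y e - m e * link (gap v e))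

/-- The indices `i` with `D i ≥ c`. -/
noncomputable def superlevel {n : ℕ} (D : Fin n → ℝ) (c : ℝ) : Finset (Fin n) :=
  Finset.univ.filter fun i => c ≤ D i

variable {n : ℕ}

@[simp] lemma mem_superlevel (D : Fin n → ℝ) (c : ℝ) (i : Fin n) :
    i ∈ superlevel D c ↔ c ≤ D i := by simp [superlevel]

lemma gap_ind (A : Finset (Fin n)) (e : Pair n) :
    gap (ind A) e = ∑ i ∈ A, gap (Pi.single i (1 : ℝ)) e := by
  simp [gap, ind, Pi.single_apply, Finset.sum_sub_distrib]

lemma hasDerivAt_objective (Y m : Pair n → ℝ) (v d : Fin n → ℝ) :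
    HasDerivAt (fun s : ℝ => objective Y m (v + s • d)) (slopeAlong Y m v d) 0 := by
  unfold objective slopeAlong
  have hg : ∀ e, ∀ s : ℝ, gap (v + s • d) e = gap v e + s * gap d e := by
    intro e s; simp [gap]; ring
  simp only [hg]
  refine HasDerivAt.fun_sum fun e _ => ?_
  have h1 : HasDerivAt (fun s : ℝ => gap v e + s * gap d e) (gap d e) 0 := by
    simpa using ((hasDerivAt_id (0 : ℝ)).mul_const (gap d e)).const_add (gap v e)
  have h2 : HasDerivAt softplus (link (gap v e)) (gap v e + 0 * gap d e) := by
    simpa using hasDerivAt_softplus (gap v e)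
  have := (h1.const_mul (Y e)).sub ((h2.comp 0 h1).const_mul (m e))
  exact this.congr_deriv (by ring)

lemma continuous_objective (Y m : Pair n → ℝ) : Continuous (objective Y m) := by
  have hs : Continuous softplus :=
    continuous_iff_continuousAt.2 fun y => (hasDerivAt_softplus y).continuousAt
  unfold objective gap
  fun_prop

lemma objective_add_const (Y m : Pair n → ℝ) (v : Fin n → ℝ) (c : ℝ) :
    objective Y m (fun i => v i + c) = objective Y m v := by
  simp [objective, gap]

/-- The tangent inequality for the concave objective. -/
lemma objective_le (Y m : Pair n → ℝ) (hm : ∀ e, 0 ≤ m e) (v w : Fin n → ℝ) :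
    objective Y m w ≤ objective Y m v + slopeAlong Y m v (w - v) := by
  unfold objective slopeAlong
  rw [← Finset.sum_add_distrib]
  refine Finset.sum_le_sum fun e _ => ?_
  have h : gap (w - v) e = gap w e - gap v e := by simp [gap]; ring
  have := mul_le_mul_of_nonneg_left (softplus_tangent_le (gap v e) (gap w e)) (hm e)
  rw [h]
  nlinarith

/-- Equality in the tangent inequality forces equal differences along the compared pairs. -/
lemma gap_eq_of_objective_eq (Y m : Pair n → ℝ) (hm : ∀ e, 0 ≤ m e) (v w : Fin n → ℝ)
    (h : objective Y m v + slopeAlong Y m v (w - v) ≤ objective Y m w) (e : Pair n)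
    (he : m e ≠ 0) : gap w e = gap v e := by
  by_contra hne
  refine h.not_gt ?_
  unfold objective slopeAlong
  rw [← Finset.sum_add_distrib]
  have hd : ∀ e, gap (w - v) e = gap w e - gap v e := by intro e; simp [gap]; ring
  refine Finset.sum_lt_sum (fun e _ => ?_) ⟨e, Finset.mem_univ e, ?_⟩
  · have := mul_le_mul_of_nonneg_left (softplus_tangent_le (gap v e) (gap w e)) (hm e)
    rw [hd]
    nlinarith
  · have := mul_lt_mul_of_pos_left (softplus_tangent_lt hne) ((hm e).lt_of_ne' he)
    rw [hd]
    nlinarith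

/-! ### Growth of superlevel sets -/

/-- If the flow `q` out of every superlevel set of `D` is small while the pairs expand, then the
superlevel sets grow geometrically until they contain more than half of the vertices. -/
lemma superlevel_growth (D : Fin n → ℝ) (top : ℝ) (htop : ∃ i, D i = top) (m q : Pair n → ℝ)
    {β γ θ ρ g : ℝ} (hg : 0 < g) (hθ0 : 0 ≤ θ) (hθ : β < θ * γ) (hm : ∀ e, 0 ≤ m e) (K : ℕ)
    (hsign : ∀ e, 0 ≤ q e * gap D e)
    (hlarge : ∀ e, g ≤ |gap D e| → θ * m e ≤ |q e|)
    (hbal : ∀ k < K, ∑ e, gap (ind (superlevel D (top - k * g))) e * q e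
      ≤ β * (superlevel D (top - k * g)).card)
    (hexp : ∀ A B : Finset (Fin n), A ⊆ B → A.Nonempty → 2 * B.card ≤ n →
      (B.card : ℝ) ≤ ρ * A.card → γ * A.card ≤ ∑ e ∈ cross A B, m e) (hρ : 0 ≤ ρ) :
    ∀ k ≤ K, n < 2 * (superlevel D (top - k * g)).card ∨
      ρ ^ k ≤ (superlevel D (top - k * g)).card := by
  obtain ⟨i₀, hi₀⟩ := htop
  have hne : ∀ k : ℕ, (superlevel D (top - k * g)).Nonempty := fun k => ⟨i₀, by
    have : 0 ≤ (k : ℝ) * g := by positivity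
    simp [hi₀, this]⟩
  intro k
  induction k with
  | zero =>
    intro _
    right
    have := (hne 0).card_pos
    simp only [pow_zero]
    exact_mod_cast this
  | succ k ih =>
    intro hk
    set A := superlevel D (top - k * g) with hA
    set B := superlevel D (top - (k + 1 : ℕ) * g) with hB
    have hAB : A ⊆ B := by
      intro i hi
      simp only [hA, hB, mem_superlevel] at hi ⊢
      push_cast
      linarith
    rcases ih (by omega) with h | h
    · left
      have := Finset.card_le_card hAB
      omega
    by_contra! hcon
    obtain ⟨hc1, hc2⟩ := hcon
    have hBA : (B.card : ℝ) ≤ ρ * A.card := by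
      rw [pow_succ'] at hc2
      exact hc2.le.trans (mul_le_mul_of_nonneg_left h hρ)
    have h1 := hexp A B hAB (hne k) hc1 hBA
    have h2 := hbal k (by omega)
    -- Pairs with both ends in `A`, or none, contribute zero. On a pair leaving `A` the sign
    -- condition makes the outward flow nonnegative, and if it ends outside `B` then `D` drops by
    -- more than `g` along it.
    have h3 : θ * ∑ e ∈ cross A B, m e ≤ ∑ e, gap (ind A) e * q e := by
      rw [Finset.mul_sum, cross, Finset.sum_filter]
      refine Finset.sum_le_sum fun e _ => ?_
      have hs := hsign e
      have hl := hlarge e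
      have hme := mul_nonneg hθ0 (hm e)
      simp only [hA, hB, mem_superlevel, gap, ind] at hs hl ⊢
      push_cast
      by_cases hx : top - k * g ≤ D e.1.1 <;> by_cases hy : top - k * g ≤ D e.1.2
      · have hx' : top - (k + 1) * g ≤ D e.1.1 := by linarith
        have hy' : top - (k + 1) * g ≤ D e.1.2 := by linarith
        simp [hx, hy, hx', hy']
      · have hpos : 0 < D e.1.1 - D e.1.2 := by linarith
        have hq := nonneg_of_mul_nonneg_left hs hpos
        simp only [hx, hy, if_true, if_false, true_and, false_and, or_false]
        split_ifs with hz
        · linarith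
        · have := hl (by rw [abs_of_pos hpos]; linarith)
          rw [abs_of_nonneg hq] at this
          linarith
      · have hpos : 0 < D e.1.2 - D e.1.1 := by linarith
        have hq : 0 ≤ -q e := nonneg_of_mul_nonneg_left (by linarith) hpos
        simp only [hx, hy, if_true, if_false, true_and, false_and, false_or]
        split_ifs with hz
        · linarith
        · have := hl (by rw [abs_of_neg (by linarith)]; linarith)
          rw [abs_of_nonpos (by linarith)] at this
          linarith
      · simp [hx, hy]
    have hApos : (0 : ℝ) < A.card := by exact_mod_cast (hne k).card_pos
    have h4 := mul_le_mul_of_nonneg_left h1 hθ0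
    nlinarith

/-! ### Existence and uniqueness of the maximizer -/

lemma slopeAlong_nonpos {Y m : Pair n → ℝ} {v d : Fin n → ℝ}
    (h : ∀ᶠ s : ℝ in 𝓝[>] 0, objective Y m (v + s • d) ≤ objective Y m v) :
    slopeAlong Y m v d ≤ 0 := by
  have h1 := ((hasDerivAt_objective Y m v d).hasDerivWithinAt (s := Set.Ioi 0))
  rw [hasDerivWithinAt_iff_tendsto_slope' (by simp)] at h1
  refine le_of_tendsto h1 ?_
  filter_upwards [h, self_mem_nhdsWithin] with s hs hs0
  rw [slope_def_field]
  have hs0 : (0 : ℝ) < s := hs0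
  apply div_nonpos_of_nonpos_of_nonneg
  · simpa using hs
  · simpa using hs0.le

lemma slopeAlong_neg (Y m : Pair n → ℝ) (v d : Fin n → ℝ) :
    slopeAlong Y m v (-d) = -slopeAlong Y m v d := by
  unfold slopeAlong
  rw [← Finset.sum_neg_distrib]
  refine Finset.sum_congr rfl fun e _ => ?_
  simp only [gap, Pi.neg_apply]
  ring

/-- Directions pointing inwards keep a point of the cube `[-R, R]ⁿ` in the cube. -/
lemma eventually_mem_cube {D d : Fin n → ℝ} {R : ℝ} (hD : ∀ i, |D i| ≤ R)
    (h1 : ∀ i, d i < 0 → -R < D i) (h2 : ∀ i, 0 < d i → D i < R) :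
    ∀ᶠ s : ℝ in 𝓝[>] 0, ∀ i, |D i + s * d i| ≤ R := by
  refine eventually_all.2 fun i => ?_
  have hc : Tendsto (fun s : ℝ => D i + s * d i) (𝓝[>] 0) (𝓝 (D i)) := by
    have : Continuous fun s : ℝ => D i + s * d i := by fun_prop
    simpa using (this.tendsto 0).mono_left nhdsWithin_le_nhds
  obtain ⟨hl, hr⟩ := abs_le.1 (hD i)
  rcases lt_trichotomy (d i) 0 with h | h | h
  · filter_upwards [hc.eventually (lt_mem_nhds (h1 i h)), self_mem_nhdsWithin] with s hs hs0
    have := mul_neg_of_pos_of_neg (Set.mem_Ioi.1 hs0) h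
    exact abs_le.2 ⟨hs.le, by linarith⟩
  · filter_upwards with s
    simpa [h] using hD i
  · filter_upwards [hc.eventually (gt_mem_nhds (h2 i h)), self_mem_nhdsWithin] with s hs hs0
    have := mul_pos (Set.mem_Ioi.1 hs0) h
    exact abs_le.2 ⟨by linarith, hs.le⟩

lemma link_neg (y : ℝ) : link (-y) = 1 - link y := by
  rw [one_sub_link, link, Real.exp_neg]
  have := Real.exp_pos y
  field_simp
  ring

lemma link_increment_sign (a δ : ℝ) : 0 ≤ (link (a + δ) - link a) * δ := by
  rcases le_total 0 δ with h | h
  · exact mul_nonneg (sub_nonneg.2 (link_strictMono.monotone (by linarith))) h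
  · exact mul_nonneg_of_nonpos_of_nonpos
      (sub_nonpos.2 (link_strictMono.monotone (by linarith))) h

/-- Monotonicity reduces to `δ = ±g`; the negative case is the positive one at `-a`, by the symmetry
`link_neg`. -/
lemma link_increment_large {a δ M g : ℝ} (ha : |a| ≤ M) (hg0 : 0 ≤ g) (hg1 : g ≤ 1)
    (hδ : g ≤ |δ|) : Real.exp (-M - 1) / 4 * g ≤ |link (a + δ) - link a| := by
  rcases le_abs.1 hδ with h | h
  · have h1 := link_add_sub_ge ha hg0 hg1
    have h2 := link_strictMono.monotone (by linarith : a + g ≤ a + δ)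
    exact (by linarith : _ ≤ link (a + δ) - link a).trans (le_abs_self _)
  · have h1 := link_add_sub_ge (x := -a) (M := M) (by rwa [abs_neg]) hg0 hg1
    have h2 := link_strictMono.monotone (by linarith : a + δ ≤ -(-a + g))
    have h3 := link_neg (-a + g)
    have h4 := link_neg a
    exact (by linarith : _ ≤ -(link (a + δ) - link a)).trans (neg_le_abs _)

lemma sum_gap_ind_le {A : Finset (Fin n)} {b : Pair n → ℝ} {β : ℝ}
    (h : ∀ i, |∑ e, gap (Pi.single i (1 : ℝ)) e * b e| ≤ β) :
    |∑ e, gap (ind A) e * b e| ≤ β * A.card := by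
  have : ∑ e, gap (ind A) e * b e = ∑ i ∈ A, ∑ e, gap (Pi.single i (1 : ℝ)) e * b e := by
    rw [Finset.sum_comm]
    simp only [gap_ind, Finset.sum_mul]
  rw [this]
  refine (Finset.abs_sum_le_sum_abs _ _).trans ((Finset.sum_le_sum fun i _ => h i).trans ?_)
  simp [mul_comm]

/-- A function with equal values along every pair with comparisons is constant if the
comparison graph expands. -/
lemma eq_zero_of_gap_eq_zero {m : Pair n → ℝ} {γ : ℝ} (hγ : 0 < γ)
    (hexp : ∀ A : Finset (Fin n), A.Nonempty → 2 * A.card ≤ n →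
      γ * A.card ≤ ∑ e ∈ cross A A, m e)
    {E : Fin n → ℝ} (hE : ∀ e, m e ≠ 0 → gap E e = 0) {i₀ : Fin n} (hi₀ : E i₀ = 0) : E = 0 := by
  classical
  -- A union of level sets of `E` is crossed by no compared pair, against expansion. Below, `S` is
  -- the zero set of `E` or its complement, whichever has at most half of the vertices.
  have key : ∀ S : Finset (Fin n), S.Nonempty → 2 * S.card ≤ n →
      (∀ i j, E i = E j → (i ∈ S ↔ j ∈ S)) → False := by
    intro S hS hSn hsat
    have h1 := hexp S hS hSn
    have hpos : 0 < ∑ e ∈ cross S S, m e :=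
      lt_of_lt_of_le (mul_pos hγ (by exact_mod_cast hS.card_pos)) h1
    obtain ⟨e, he, hne⟩ := Finset.exists_ne_zero_of_sum_ne_zero hpos.ne'
    have hg := hE e hne
    have := hsat _ _ (sub_eq_zero.1 hg)
    simp only [cross, Finset.mem_filter] at he
    tauto
  set A : Finset (Fin n) := Finset.univ.filter fun i => E i = 0 with hA
  have hsat : ∀ i j, E i = E j → (i ∈ A ↔ j ∈ A) := by
    intro i j hij
    simp [hA, hij]
  have hcard : A.card + Aᶜ.card = n := by simp
  by_contra hne
  obtain ⟨j, hj⟩ := Function.ne_iff.1 hne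
  by_cases h : 2 * A.card ≤ n
  · exact key A ⟨i₀, by simp [hA, hi₀]⟩ h hsat
  · refine key Aᶜ ⟨j, by simpa [hA] using hj⟩ (by omega) fun i j hij => ?_
    rw [Finset.mem_compl, Finset.mem_compl, hsat i j hij]

/-- If the objective has a maximizer over a large cube around `u` centred with respect to
translations, its error has small range. -/
lemma error_le_of_isMax_cube {u v : Fin n → ℝ} {Y m : Pair n → ℝ} (hm : ∀ e, 0 ≤ m e)
    {M β γ ρ g R : ℝ} (hM : ∀ e : Pair n, |gap u e| ≤ M) (hg0 : 0 < g) (hg1 : g ≤ 1)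
    (hρ : 0 ≤ ρ) (hβγ : β < Real.exp (-M - 1) / 4 * g * γ) {K : ℕ} (hK : (n : ℝ) < 2 * ρ ^ K)
    (hnoise : ∀ i, |∑ e, gap (Pi.single i (1 : ℝ)) e * (Y e - m e * link (gap u e))| ≤ β)
    (hexp : ∀ A B : Finset (Fin n), A ⊆ B → A.Nonempty → 2 * B.card ≤ n →
      (B.card : ℝ) ≤ ρ * A.card → γ * A.card ≤ ∑ e ∈ cross A B, m e)
    (hR : K * g < R) (hv : ∀ i, |(v - u) i| ≤ R)
    (hmax : ∀ w : Fin n → ℝ, (∀ i, |(w - u) i| ≤ R) → objective Y m w ≤ objective Y m v)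
    {t : ℝ} (ht0 : 0 ≤ t) (htop : ∃ i, (v - u) i = t) (hbot : ∃ i, (v - u) i = -t) :
    t ≤ K * g := by
  set D := v - u with hD
  have hgap : ∀ e, gap v e = gap u e + gap D e := by
    intro e; simp [gap, hD]; ring
  set q : Pair n → ℝ := fun e => m e * (link (gap v e) - link (gap u e)) with hq
  -- The maximizer may lie on the boundary of the cube, so only first-order inequalities in inward
  -- directions are available. The argument needs no more: superlevel sets are pushed down, sublevel
  -- sets up.
  have hfeas : ∀ d : Fin n → ℝ, (∀ i, d i < 0 → -R < D i) → (∀ i, 0 < d i → D i < R) →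
      slopeAlong Y m v d ≤ 0 := by
    intro d h1 h2
    refine slopeAlong_nonpos ?_
    filter_upwards [eventually_mem_cube hv h1 h2] with s hs
    refine hmax _ fun i => ?_
    have : (v + s • d - u) i = D i + s * d i := by simp [hD]; ring
    rw [this]
    exact hs i
  have hsplit : ∀ A : Finset (Fin n), ∑ e, gap (ind A) e * q e
      = ∑ e, gap (ind A) e * (Y e - m e * link (gap u e)) - slopeAlong Y m v (ind A) := by
    intro A
    unfold slopeAlong
    rw [← Finset.sum_sub_distrib]
    refine Finset.sum_congr rfl fun e _ => ?_
    simp only [hq]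
    ring
  have hsign : ∀ e, 0 ≤ q e * gap D e := by
    intro e
    have := mul_nonneg (hm e) (link_increment_sign (gap u e) (gap D e))
    simp only [hq, hgap]
    linarith
  have hlarge : ∀ e, g ≤ |gap D e| → Real.exp (-M - 1) / 4 * g * m e ≤ |q e| := by
    intro e he
    have := mul_le_mul_of_nonneg_left (link_increment_large (hM e) hg0.le hg1 he) (hm e)
    simp only [hq, hgap, abs_mul, abs_of_nonneg (hm e)]
    linarith
  have hkg : ∀ k < K, (k : ℝ) * g ≤ K * g := fun k hk => by
    have : (k : ℝ) ≤ K := by exact_mod_cast hk.le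
    gcongr
  have hind : ∀ (A : Finset (Fin n)) i, ¬ ind A i < 0 := by
    intro A i
    unfold ind
    split_ifs <;> norm_num
  have hind' : ∀ (A : Finset (Fin n)) i, 0 < ind A i → i ∈ A := by
    intro A i
    unfold ind
    split_ifs with h <;> simp [h]
  -- Pushing down is feasible because `t ≥ 0` and `k * g < R` keep `D ≥ t - k * g > -R` on the
  -- superlevel set.
  have hupper := superlevel_growth D t htop m q hg0 (by positivity) hβγ hm K hsign hlarge
    (fun k hk => by
      have h1 := hfeas (-ind (superlevel D (t - k * g)))
        (fun i hi => by
          have h := hind' _ i (by simpa using hi)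
          rw [mem_superlevel] at h
          linarith [hkg k hk])
        (fun i hi => (hind _ i (by simpa using hi)).elim)
      rw [slopeAlong_neg] at h1
      have h2 := (abs_le.1 (sum_gap_ind_le (A := superlevel D (t - k * g)) hnoise)).2
      rw [hsplit]
      linarith) hexp hρ K le_rfl
  have hneg : ∀ e, gap (-D) e = -gap D e := by
    intro e; simp [gap]; ring
  have hlower := superlevel_growth (-D) t (by simpa [neg_eq_iff_eq_neg] using hbot) m (-q) hg0
    (by positivity) hβγ hm K
    (fun e => by simpa [hneg] using hsign e)
    (fun e he => by
      rw [hneg, abs_neg] at he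
      simpa using hlarge e he)
    (fun k hk => by
      have h1 := hfeas (ind (superlevel (-D) (t - k * g)))
        (fun i hi => (hind _ i hi).elim)
        (fun i hi => by
          have h := hind' _ i hi
          rw [mem_superlevel, Pi.neg_apply] at h
          linarith [hkg k hk])
      have h2 := (abs_le.1 (sum_gap_ind_le (A := superlevel (-D) (t - k * g)) hnoise)).1
      simp only [Pi.neg_apply, mul_neg, Finset.sum_neg_distrib]
      rw [hsplit]
      linarith) hexp hρ K le_rfl
  have hhalf : ∀ A : Finset (Fin n), (n < 2 * A.card ∨ ρ ^ K ≤ A.card) → n < 2 * A.card := by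
    intro A h
    rcases h with h | h
    · exact h
    · have : (n : ℝ) < ((2 * A.card : ℕ) : ℝ) := by push_cast; linarith
      exact_mod_cast this
  have h1 := hhalf _ hupper
  have h2 := hhalf _ hlower
  -- Two sets of more than `n / 2` vertices meet; at a common vertex both `D i` and `-D i` are at
  -- least `t - K * g`.
  obtain ⟨i, hi⟩ : (superlevel D (t - K * g) ∩ superlevel (-D) (t - K * g)).Nonempty := by
    rw [← Finset.card_pos]
    have h3 := Finset.card_union_add_card_inter (superlevel D (t - K * g))
      (superlevel (-D) (t - K * g))
    have h4 := Finset.card_le_univ (superlevel D (t - K * g) ∪ superlevel (-D) (t - K * g))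
    simp only [Fintype.card_fin] at h4
    omega
  simp only [Finset.mem_inter, mem_superlevel, Pi.neg_apply] at hi
  linarith [hi.1, hi.2]

/-- Existence, uniqueness and accuracy of the maximizer of the objective, for data with small
noise at every vertex and an expanding comparison graph. -/
theorem exists_unique_maximizer (hn : 0 < n) {u : Fin n → ℝ} (hu : Anchored u)
    {Y m : Pair n → ℝ} (hm : ∀ e, 0 ≤ m e)
    {M β γ ρ g : ℝ} (hM : ∀ e : Pair n, |gap u e| ≤ M) (hg0 : 0 < g) (hg1 : g ≤ 1)
    (hρ : 1 ≤ ρ) (hγ : 0 < γ)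
    (hβγ : β < Real.exp (-M - 1) / 4 * g * γ) {K : ℕ} (hK : (n : ℝ) < 2 * ρ ^ K)
    (hnoise : ∀ i, |∑ e, gap (Pi.single i (1 : ℝ)) e * (Y e - m e * link (gap u e))| ≤ β)
    (hexp : ∀ A B : Finset (Fin n), A ⊆ B → A.Nonempty → 2 * B.card ≤ n →
      (B.card : ℝ) ≤ ρ * A.card → γ * A.card ≤ ∑ e ∈ cross A B, m e) :
    ∃ v : Fin n → ℝ, Anchored v ∧ (∀ w, objective Y m w ≤ objective Y m v) ∧
      (∀ w, Anchored w → objective Y m v ≤ objective Y m w → w = v) ∧ ‖v - u‖ ≤ 2 * (K * g) := by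
  have hKg : 0 ≤ (K : ℝ) * g := by positivity
  -- Any radius above `K * g` would do: the error bound then forces the recentred maximizer into the
  -- interior.
  set R : ℝ := K * g + 1 with hR
  have hR0 : 0 < R := by positivity
  have hball : ∀ w : Fin n → ℝ, w ∈ Metric.closedBall u R ↔ ∀ i, |(w - u) i| ≤ R := by
    intro w
    rw [mem_closedBall_iff_norm, pi_norm_le_iff_of_nonneg hR0.le]
    rfl
  obtain ⟨v₀, hv₀, hmax₀⟩ := (isCompact_closedBall u R).exists_isMaxOn
    ⟨u, Metric.mem_closedBall_self hR0.le⟩ (continuous_objective Y m).continuousOn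
  rw [hball] at hv₀
  have : Nonempty (Fin n) := ⟨⟨0, hn⟩⟩
  obtain ⟨i₁, hi₁⟩ := Finite.exists_max (v₀ - u)
  obtain ⟨i₂, hi₂⟩ := Finite.exists_min (v₀ - u)
  set a := (v₀ - u) i₁ with ha
  set b := (v₀ - u) i₂ with hb
  have hba : b ≤ a := hi₁ i₂
  -- The objective is translation invariant, so the error may be centred to have extremes `±(a - b)
  -- / 2`; this keeps `v` in the cube.
  set v : Fin n → ℝ := fun i => v₀ i + (-((a + b) / 2)) with hv
  have hvD : ∀ i, (v - u) i = (v₀ - u) i - (a + b) / 2 := by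
    intro i; simp [hv]; ring
  have hvt : ∀ i, |(v - u) i| ≤ (a - b) / 2 := by
    intro i
    rw [hvD, abs_le]
    constructor <;> linarith [hi₁ i, hi₂ i]
  have hobj : objective Y m v = objective Y m v₀ := objective_add_const _ _ _ _
  have hle : (a - b) / 2 ≤ R := by
    linarith [(abs_le.1 (hv₀ i₁)).2, (abs_le.1 (hv₀ i₂)).1]
  have hmaxv : ∀ w : Fin n → ℝ, (∀ i, |(w - u) i| ≤ R) → objective Y m w ≤ objective Y m v := by
    intro w hw
    rw [hobj]
    exact hmax₀ ((hball w).2 hw)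
  have ht := error_le_of_isMax_cube hm hM hg0 hg1 (by linarith) hβγ hK hnoise hexp
    (by linarith : (K : ℝ) * g < R) (fun i => (hvt i).trans hle) hmaxv
    (by linarith : 0 ≤ (a - b) / 2) ⟨i₁, by rw [hvD]; ring⟩ ⟨i₂, by rw [hvD]; ring⟩
  have hstat : ∀ d, slopeAlong Y m v d = 0 := by
    have h : ∀ d, slopeAlong Y m v d ≤ 0 := by
      intro d
      refine slopeAlong_nonpos ?_
      filter_upwards [eventually_mem_cube (D := v - u) (d := d) (fun i => (hvt i).trans hle)
        (fun i _ => by linarith [(abs_le.1 (hvt i)).1])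
        (fun i _ => by linarith [(abs_le.1 (hvt i)).2])] with s hs
      refine hmaxv _ fun i => ?_
      have : (v + s • d - u) i = (v - u) i + s * d i := by simp; ring
      rw [this]
      exact hs i
    intro d
    have := h (-d)
    rw [slopeAlong_neg] at this
    exact le_antisymm (h d) (by linarith)
  set o : Fin n := ⟨0, hn⟩ with ho
  set v' : Fin n → ℝ := fun i => v i + (-v o) with hv'
  have hobj' : objective Y m v' = objective Y m v := objective_add_const _ _ _ _
  have hgap' : ∀ e, gap v' e = gap v e := by
    intro e; simp [hv', gap]
  have hanch : ∀ {w : Fin n → ℝ}, Anchored w → w o = 0 := fun hw => hw o rfl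
  refine ⟨v', fun i hi => ?_, fun w => ?_, fun w hw hwv => ?_, ?_⟩
  · have : i = o := Fin.ext hi
    simp [hv', this]
  · have := objective_le Y m hm v w
    rw [hstat] at this
    linarith
  · have h1 := gap_eq_of_objective_eq Y m hm v w (by rw [hstat]; linarith)
    -- Expansion with `B = A`, allowed since `ρ ≥ 1`, is the connectedness needed here.
    have h2 := eq_zero_of_gap_eq_zero (E := w - v') (i₀ := o) hγ
      (fun A hA hAn => hexp A A subset_rfl hA hAn (le_mul_of_one_le_left (by positivity) hρ))
      (fun e he => by
        have h3 := h1 e he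
        have h4 := hgap' e
        simp only [gap, Pi.sub_apply] at h3 h4 ⊢
        linarith)
      (by simp [hanch hw, hv'])
    exact sub_eq_zero.1 h2
  -- Passing from the centred to the anchored normalization costs the factor 2.
  · rw [pi_norm_le_iff_of_nonneg (by positivity)]
    intro i
    have h1 : (v' - u) i = (v - u) i - (v - u) o := by
      simp [hv', hanch hu]; ring
    rw [h1, Real.norm_eq_abs]
    have h2 := abs_sub ((v - u) i) ((v - u) o)
    linarith [hvt i, hvt o]

variable {T : ℕ}

/-! ### The log-likelihood as an objective -/

/-- The observed comparisons among `T` potential ones when `k` are made. -/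
def observed (T k : ℕ) : Finset (Fin T) := Finset.univ.filter fun t => (t : ℕ) < k

/-- The number of wins among the first `k` comparisons. -/
noncomputable def wins (k : ℕ) (x : Fin T → ℤˣ) : ℝ := ∑ t ∈ observed T k, if x t = 1 then 1 else 0

lemma card_observed {k : ℕ} (hk : k ≤ T) : (observed T k).card = k := by
  have : (observed T k).map Fin.valEmbedding = Finset.range k := by
    ext a
    simp only [observed, Finset.mem_map, Finset.mem_filter, Finset.mem_univ, true_and,
      Fin.valEmbedding_apply, Finset.mem_range]
    exact ⟨fun ⟨t, ht, hta⟩ => hta ▸ ht, fun ha => ⟨⟨a, ha.trans_le hk⟩, ha, rfl⟩⟩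
  rw [← Finset.card_map Fin.valEmbedding, this, Finset.card_range]

lemma log_mass (x : ℤˣ) (y : ℝ) :
    Real.log (mass x y) = (if x = 1 then 1 else 0) * y - softplus y := by
  unfold mass
  split_ifs
  · rw [log_link]; ring
  · rw [log_one_sub_link]; ring

/-- The logistic link is canonical, so outcomes enter linearly. The weight is the size of `observed
T (N e)`, not `N e`, which makes the identity hold at every sample point and not only where `N e ≤
T`. -/
lemma logLik_eq_objective (N : Pair n → ℕ) (X : Pair n → Fin T → ℤˣ) :
    logLik N X = objective (fun e => wins (N e) (X e)) (fun e => (observed T (N e)).card) := by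
  funext v
  unfold logLik objective
  refine Finset.sum_congr rfl fun e _ => ?_
  simp only [log_mass, Finset.sum_sub_distrib, ← Finset.sum_mul, Finset.sum_const, nsmul_eq_mul]
  rfl

/-! ### Exponential moments of sums over observed comparisons -/

instance : MeasurableSingletonClass ℤˣ :=
  ⟨fun x => ⟨{(x : ℤ)}, measurableSet_singleton _, by ext y; simp [Units.ext_iff]⟩⟩

variable {Ω : Type*} [MeasurableSpace Ω] {μ : Measure Ω} [IsProbabilityMeasure μ]

lemma integral_comp_sign {X : Ω → ℤˣ} (hX : Measurable X) (φ : ℤˣ → ℝ) :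
    ∫ ω, φ (X ω) ∂μ = φ 1 * μ.real {ω | X ω = 1} + φ (-1) * μ.real {ω | X ω = -1} := by
  have hs : ∀ x, MeasurableSet {ω | X ω = x} := fun x => hX (measurableSet_singleton x)
  have : ∀ ω, φ (X ω) = φ 1 * {ω | X ω = 1}.indicator 1 ω + φ (-1) * {ω | X ω = -1}.indicator 1 ω := by
    intro ω
    rcases Int.units_eq_one_or (X ω) with h | h <;> simp [Set.indicator, h]
  simp only [this]
  rw [integral_add, integral_const_mul, integral_const_mul, integral_indicator_one (hs _),
    integral_indicator_one (hs _)]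
  · exact ((integrable_const (1 : ℝ)).indicator (hs _)).const_mul _
  · exact ((integrable_const (1 : ℝ)).indicator (hs _)).const_mul _

lemma integrable_comp_discrete {β : Type*} [MeasurableSpace β] [DiscreteMeasurableSpace β]
    {Z : Ω → β} (hZ : Measurable Z) (f : β → ℝ) (C : ℝ) (hC : ∀ b, |f b| ≤ C) :
    Integrable (fun ω => f (Z ω)) μ :=
  Integrable.of_bound ((Measurable.of_discrete (f := f)).comp hZ).aestronglyMeasurable C
    (ae_of_all _ fun _ => hC _)

/-- A product over a binomial number of independent factors. -/
lemma integral_prod_observed_le {p : ℝ} {N : Ω → ℕ} {X : Fin T → Ω → ℤˣ} (hN : Measurable N)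
    (hX : ∀ t, Measurable (X t))
    (hcount : ∀ k, μ.real {ω | N ω = k} = (T.choose k : ℝ) * p ^ k * (1 - p) ^ (T - k))
    (hNX : IndepFun N (fun ω t => X t ω) μ) (hXX : iIndepFun X μ) (φ : ℤˣ → ℝ)
    (hφ0 : ∀ x, 0 ≤ φ x) {c : ℝ} (hφ : ∀ t, ∫ ω, φ (X t ω) ∂μ ≤ c) :
    ∫ ω, ∏ t ∈ observed T (N ω), φ (X t ω) ∂μ ≤ (p * c + (1 - p)) ^ T := by
  have hXm : Measurable fun ω t => X t ω := measurable_pi_lambda _ hX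
  have hle : ∀ᵐ ω ∂μ, N ω ≤ T := by
    have : ∀ k, ∀ᵐ ω ∂μ, T < k → N ω ≠ k := by
      intro k
      by_cases hk : T < k
      · have h0 := hcount k
        rw [Nat.choose_eq_zero_of_lt hk, Nat.cast_zero, zero_mul, zero_mul,
          measureReal_eq_zero_iff] at h0
        filter_upwards [measure_eq_zero_iff_ae_notMem.1 h0] with ω hω _
        exact hω
      · filter_upwards with ω h
        exact absurd h hk
    filter_upwards [ae_all_iff.2 this] with ω hω
    by_contra h
    exact hω (N ω) (not_le.1 h) rfl
  have hset : ∀ k, MeasurableSet {ω | N ω = k} := fun k => hN (measurableSet_singleton k)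
  -- Splitting by the value of the count replaces the random index set by fixed ones; the binomial
  -- theorem resums the pieces.
  have hdec : (fun ω => ∏ t ∈ observed T (N ω), φ (X t ω)) =ᵐ[μ] fun ω =>
      ∑ k ∈ Finset.range (T + 1),
        {ω | N ω = k}.indicator (1 : Ω → ℝ) ω * ∏ t ∈ observed T k, φ (X t ω) := by
    filter_upwards [hle] with ω hω
    rw [Finset.sum_eq_single_of_mem (N ω) (Finset.mem_range.2 (by omega))]
    · simp
    · intro k _ hk
      simp [Set.indicator, hk.symm]
  have hprodm : ∀ k, Measurable fun ω => ∏ t ∈ observed T k, φ (X t ω) := fun k =>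
    (Measurable.of_discrete (f := fun x : Fin T → ℤˣ => ∏ t ∈ observed T k, φ (x t))).comp hXm
  have hprodi : ∀ k, Integrable (fun ω => ∏ t ∈ observed T k, φ (X t ω)) μ := fun k =>
    integrable_comp_discrete hXm (fun x : Fin T → ℤˣ => ∏ t ∈ observed T k, φ (x t))
      (∑ x : Fin T → ℤˣ, |∏ t ∈ observed T k, φ (x t)|)
      (fun x => Finset.single_le_sum (f := fun x : Fin T → ℤˣ => |∏ t ∈ observed T k, φ (x t)|)
        (fun _ _ => abs_nonneg _) (Finset.mem_univ x))
  have hprod : ∀ k ≤ T, ∫ ω, ∏ t ∈ observed T k, φ (X t ω) ∂μ ≤ c ^ k := by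
    intro k hk
    have h1 : ∀ ω, ∏ t ∈ observed T k, φ (X t ω)
        = ∏ t : Fin T, (if (t : ℕ) < k then φ else fun _ => 1) (X t ω) := by
      intro ω
      rw [observed, Finset.prod_filter]
      refine Finset.prod_congr rfl fun t _ => ?_
      split_ifs <;> rfl
    simp only [h1]
    have h2 := hXX.comp (fun t => if (t : ℕ) < k then φ else fun _ => 1)
      (fun t => Measurable.of_discrete)
    have h3 := h2.integral_fun_prod_eq_prod_integral
      (fun t => (Measurable.of_discrete.comp (hX t)).aestronglyMeasurable)
    simp only [Function.comp_apply] at h3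
    rw [h3]
    calc ∏ t : Fin T, ∫ ω, (if (t : ℕ) < k then φ else fun _ => 1) (X t ω) ∂μ
        ≤ ∏ t : Fin T, if (t : ℕ) < k then c else 1 := by
          refine Finset.prod_le_prod (fun t _ => integral_nonneg fun ω => ?_) fun t _ => ?_
          · split_ifs
            · exact hφ0 _
            · exact zero_le_one
          · split_ifs
            · exact hφ t
            · simp
      _ = c ^ k := by
          rw [← Finset.prod_filter, Finset.prod_const]
          congr 1
          exact card_observed hk
  have hterm : ∀ k ≤ T, ∫ ω, {ω | N ω = k}.indicator (1 : Ω → ℝ) ω *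
      ∏ t ∈ observed T k, φ (X t ω) ∂μ ≤ (T.choose k : ℝ) * p ^ k * (1 - p) ^ (T - k) * c ^ k := by
    intro k hk
    have h1 : IndepFun (fun ω => {ω | N ω = k}.indicator (1 : Ω → ℝ) ω)
        (fun ω => ∏ t ∈ observed T k, φ (X t ω)) μ := by
      have := hNX.comp (φ := fun j : ℕ => if j = k then (1 : ℝ) else 0)
        (ψ := fun x : Fin T → ℤˣ => ∏ t ∈ observed T k, φ (x t))
        Measurable.of_discrete Measurable.of_discrete
      convert this using 1
      · funext ω
        simp [Set.indicator]
      · rfl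
    rw [h1.integral_fun_mul_eq_mul_integral
      ((measurable_one.indicator (hset k)).aestronglyMeasurable) (hprodm k).aestronglyMeasurable,
      integral_indicator_one (hset k), ← hcount k]
    exact mul_le_mul_of_nonneg_left (hprod k hk) measureReal_nonneg
  rw [integral_congr_ae hdec, integral_finsetSum]
  · calc _ ≤ ∑ k ∈ Finset.range (T + 1),
          (T.choose k : ℝ) * p ^ k * (1 - p) ^ (T - k) * c ^ k :=
          Finset.sum_le_sum fun k hk => hterm k (by simpa [Nat.lt_succ_iff] using hk)
      _ = (p * c + (1 - p)) ^ T := by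
          rw [add_pow]
          refine Finset.sum_congr rfl fun k _ => ?_
          rw [mul_pow]
          ring
  · intro k _
    have h := (hprodi k).indicator (hset k)
    refine h.congr (ae_of_all _ fun ω => ?_)
    by_cases hω : N ω = k <;> simp [Set.indicator, hω]

/-- Chernoff's bound for sums over the observed comparisons of a sample. -/
lemma IsSample.chernoff {p : ℝ} {u : Fin n → ℝ} {N : Pair n → Ω → ℕ}
    {X : Pair n → Fin T → Ω → ℤˣ} (h : IsSample μ T p u N X) (hp : p ∈ Set.Icc (0 : ℝ) 1)
    (ψ : Pair n → ℤˣ → ℝ) (b : Pair n → ℝ)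
    (hψ : ∀ e, link (gap u e) * Real.exp (ψ e 1) + (1 - link (gap u e)) * Real.exp (ψ e (-1))
      ≤ 1 + b e) (ε : ℝ) :
    μ.real {ω | ε ≤ ∑ e, ∑ t ∈ observed T (N e ω), ψ e (X e t ω)}
      ≤ Real.exp (-ε + T * p * ∑ e, b e) := by
  set F : ∀ _ : Pair n, ℕ × (Fin T → ℤˣ) → ℝ := fun e z => ∑ t ∈ observed T z.1, ψ e (z.2 t) with hF
  set Z : Pair n → Ω → ℝ := fun e ω => F e (N e ω, fun t => X e t ω) with hZ
  have hmeas : ∀ e, Measurable fun ω => (N e ω, fun t => X e t ω) := fun e =>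
    (h.measurable_count e).prodMk (measurable_pi_lambda _ (h.measurable_outcome e))
  have hZm : ∀ e, Measurable (Z e) := fun e =>
    (Measurable.of_discrete (f := F e)).comp (hmeas e)
  have hZind : iIndepFun Z μ := h.indep_pairs.comp F fun e => Measurable.of_discrete
  have hZint : ∀ e, Integrable (fun ω => Real.exp (1 * Z e ω)) μ := by
    intro e
    refine integrable_comp_discrete (hmeas e) (fun z => Real.exp (1 * F e z))
      (Real.exp (∑ _t : Fin T, ∑ x : ℤˣ, |ψ e x|)) fun z => ?_
    rw [Real.abs_exp, Real.exp_le_exp, one_mul]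
    refine (Finset.sum_le_sum fun t _ => ?_).trans
      (Finset.sum_le_sum_of_subset_of_nonneg (Finset.subset_univ (observed T z.1))
        fun _ _ _ => Finset.sum_nonneg fun _ _ => abs_nonneg _)
    exact (le_abs_self _).trans (Finset.single_le_sum (f := fun x => |ψ e x|)
      (fun _ _ => abs_nonneg _) (Finset.mem_univ (z.2 t)))
  have hmgf : ∀ e, mgf (Z e) μ 1 ≤ Real.exp (T * p * b e) := by
    intro e
    have h1 := integral_prod_observed_le (h.measurable_count e) (h.measurable_outcome e)
      (h.count_law e) (h.indep_count_outcomes e) (h.indep_outcomes e)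
      (fun x => Real.exp (ψ e x)) (fun x => (Real.exp_pos _).le) (c := 1 + b e) (fun t => by
        rw [integral_comp_sign (h.measurable_outcome e t) (fun x => Real.exp (ψ e x)),
          h.outcome_law, h.outcome_law]
        have := hψ e
        simp only [gap] at this
        simp only [mass, if_true]
        rw [if_neg (by decide)]
        linarith)
    have h2 : mgf (Z e) μ 1 = ∫ ω, ∏ t ∈ observed T (N e ω), Real.exp (ψ e (X e t ω)) ∂μ := by
      simp only [mgf, hZ, hF, one_mul, Real.exp_sum]
    rw [h2]
    refine h1.trans ?_
    have hb : 0 ≤ 1 + b e := by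
      refine le_trans ?_ (hψ e)
      have := link_pos (gap u e)
      have := link_lt_one (gap u e)
      have h3 := Real.exp_pos (ψ e 1)
      have h4 := Real.exp_pos (ψ e (-1))
      exact add_nonneg (by positivity) (mul_nonneg (by linarith) h4.le)
    have h5 : 0 ≤ p * (1 + b e) + (1 - p) :=
      add_nonneg (mul_nonneg hp.1 hb) (by linarith [hp.2])
    calc (p * (1 + b e) + (1 - p)) ^ T ≤ (Real.exp (p * b e)) ^ T := by
          gcongr
          linarith [Real.add_one_le_exp (p * b e)]
      _ = Real.exp (T * p * b e) := by
          rw [← Real.exp_nat_mul]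
          ring_nf
  -- The tilt is fixed at 1, since any other parameter can be absorbed into `ψ`.
  have h1 := measure_ge_le_exp_mul_mgf (μ := μ) (X := ∑ e, Z e) (t := 1) ε zero_le_one
    (hZind.integrable_exp_mul_sum hZm fun e _ => hZint e)
  have h2 : {ω | ε ≤ (∑ e, Z e) ω} = {ω | ε ≤ ∑ e, ∑ t ∈ observed T (N e ω), ψ e (X e t ω)} := by
    ext ω
    simp [hZ, hF, Finset.sum_apply]
  rw [h2, hZind.mgf_sum hZm] at h1
  refine h1.trans ?_
  rw [Real.exp_add, Finset.mul_sum, Real.exp_sum, neg_one_mul]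
  gcongr with e
  · exact fun e _ => mgf_nonneg
  · exact hmgf e

/-! ### Tail bounds for the noise and for the expansion of the comparison graph -/

/-- By `exp x ≤ 1 + x + x ^ 2` on `[-1, 1]`: the linear terms cancel by centring, and the quadratic
ones sum to `a ^ 2 * q * (1 - q)`. -/
lemma centred_sign_mgf_le {q a : ℝ} (hq0 : 0 ≤ q) (hq1 : q ≤ 1) (ha : |a| ≤ 1) :
    q * Real.exp (a * (1 - q)) + (1 - q) * Real.exp (a * (0 - q)) ≤ 1 + a ^ 2 := by
  have key : ∀ x : ℝ, |x| ≤ 1 → Real.exp x ≤ 1 + x + x ^ 2 := fun x hx => by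
    linarith [(abs_le.1 (Real.abs_exp_sub_one_sub_id_le hx)).2]
  have h1 := key (a * (1 - q)) (by
    rw [abs_mul, abs_of_nonneg (by linarith : 0 ≤ 1 - q)]
    exact mul_le_one₀ ha (by linarith) (by linarith))
  have h2 := key (a * (0 - q)) (by
    rw [abs_mul, zero_sub, abs_neg, abs_of_nonneg hq0]
    exact mul_le_one₀ ha hq0 hq1)
  have h3 := mul_le_mul_of_nonneg_left h1 hq0
  have h4 := mul_le_mul_of_nonneg_left h2 (by linarith : 0 ≤ 1 - q)
  have h5 : q * (1 - q) ≤ 1 := by nlinarith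
  have h6 := mul_le_mul_of_nonneg_left h5 (sq_nonneg a)
  nlinarith

lemma abs_gap_single_le (i : Fin n) (e : Pair n) : |gap (Pi.single i (1 : ℝ)) e| ≤ 1 := by
  simp only [gap, Pi.single_apply]
  split_ifs <;> norm_num

lemma sum_gap_single_sq_le (i : Fin n) : ∑ e, gap (Pi.single i (1 : ℝ)) e ^ 2 ≤ 2 * n := by
  have h1 : ∀ e : Pair n, gap (Pi.single i (1 : ℝ)) e ^ 2
      ≤ (if e.1.1 = i then 1 else 0) + (if e.1.2 = i then 1 else 0) := by
    intro e
    simp only [gap, Pi.single_apply]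
    split_ifs <;> norm_num
  refine (Finset.sum_le_sum fun e _ => h1 e).trans ?_
  rw [Finset.sum_add_distrib, Finset.sum_boole, Finset.sum_boole, two_mul]
  refine add_le_add (Nat.cast_le.2 ?_) (Nat.cast_le.2 ?_)
  · refine (Finset.card_le_card_of_injOn (fun e : Pair n => e.1.2) (fun _ _ => Finset.mem_univ _)
      ?_).trans (Finset.card_fin n).le
    intro e he e' he' h
    simp only [Finset.coe_filter, Finset.mem_univ, true_and, Set.mem_ofPred_eq] at he he'
    exact Subtype.ext (Prod.ext (he.trans he'.symm) h)
  · refine (Finset.card_le_card_of_injOn (fun e : Pair n => e.1.1) (fun _ _ => Finset.mem_univ _)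
      ?_).trans (Finset.card_fin n).le
    intro e he e' he' h
    simp only [Finset.coe_filter, Finset.mem_univ, true_and, Set.mem_ofPred_eq] at he he'
    exact Subtype.ext (Prod.ext h (he.trans he'.symm))

lemma card_mul_le_card_cross {A B : Finset (Fin n)} (hAB : A ⊆ B) :
    A.card * (n - B.card) ≤ (cross A B).card := by
  classical
  have h1 : (A ×ˢ Bᶜ).card = A.card * (n - B.card) := by
    rw [Finset.card_product, Finset.card_compl, Fintype.card_fin]
  rw [← h1]
  -- Each crossing pair is oriented from `A` to the complement of `B`; `A ⊆ B` makes the orientation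
  -- unambiguous.
  refine Finset.card_le_card_of_surjOn
    (fun e : Pair n => if e.1.1 ∈ A ∧ e.1.2 ∉ B then (e.1.1, e.1.2) else (e.1.2, e.1.1)) ?_
  rintro ⟨i, j⟩ hij
  simp only [Finset.coe_product, Set.mem_prod, Finset.mem_coe, Finset.mem_compl] at hij
  obtain ⟨hi, hj⟩ := hij
  have hne : i ≠ j := by
    rintro rfl
    exact hj (hAB hi)
  rcases hne.lt_or_gt with h | h
  · exact ⟨⟨(i, j), h⟩, by simp [cross, hi, hj], by simp [hi, hj]⟩
  · refine ⟨⟨(j, i), h⟩, by simp [cross, hi, hj], ?_⟩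
    have : ¬ (j ∈ A ∧ i ∉ B) := fun h' => h'.2 (hAB hi)
    simp [this]

/-- The score of the data at the vertex `i` under the scores `u`. -/
noncomputable def vertexNoise (u : Fin n → ℝ) (N : Pair n → ℕ) (X : Pair n → Fin T → ℤˣ)
    (i : Fin n) : ℝ :=
  ∑ e, gap (Pi.single i (1 : ℝ)) e *
    (wins (N e) (X e) - (observed T (N e)).card * link (gap u e))

variable {p : ℝ} {u : Fin n → ℝ} {N : Pair n → Ω → ℕ} {X : Pair n → Fin T → Ω → ℤˣ}

lemma IsSample.signed_vertexNoise_tail (h : IsSample μ T p u N X) (hp : p ∈ Set.Icc (0 : ℝ) 1)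
    (i : Fin n) {l s : ℝ} (hl0 : 0 ≤ l) (hl1 : l ≤ 1) (hs : |s| = 1) (β : ℝ) :
    μ.real {ω | β ≤ s * vertexNoise u (fun e => N e ω) (fun e t => X e t ω) i}
      ≤ Real.exp (-(l * β) + T * p * (2 * n * l ^ 2)) := by
  have h1 := h.chernoff hp
    (fun e x => s * l * gap (Pi.single i (1 : ℝ)) e * ((if x = 1 then 1 else 0) - link (gap u e)))
    (fun e => (s * l * gap (Pi.single i (1 : ℝ)) e) ^ 2) (fun e => by
      have := centred_sign_mgf_le (link_pos (gap u e)).le (link_lt_one (gap u e)).le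
        (a := s * l * gap (Pi.single i (1 : ℝ)) e) (by
          rw [abs_mul, abs_mul, hs, one_mul, abs_of_nonneg hl0]
          exact mul_le_one₀ hl1 (abs_nonneg _) (abs_gap_single_le i e))
      simp only [if_true]
      rw [if_neg (by decide)]
      exact this) (l * β)
  have hs2 : s ^ 2 = 1 := by rw [← sq_abs, hs, one_pow]
  refine (measureReal_mono ?_).trans (h1.trans (Real.exp_le_exp.2 ?_))
  · intro ω hω
    simp only [Set.mem_ofPred_eq] at hω ⊢
    refine (mul_le_mul_of_nonneg_left hω hl0).trans_eq ?_
    unfold vertexNoise wins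
    rw [Finset.mul_sum, Finset.mul_sum]
    refine Finset.sum_congr rfl fun e _ => ?_
    rw [← Finset.mul_sum, Finset.sum_sub_distrib, Finset.sum_const, nsmul_eq_mul]
    ring
  · have h2 : ∑ e, (s * l * gap (Pi.single i (1 : ℝ)) e) ^ 2 ≤ 2 * n * l ^ 2 := by
      simp only [mul_pow, hs2, one_mul]
      rw [← Finset.mul_sum, mul_comm]
      exact mul_le_mul_of_nonneg_right (sum_gap_single_sq_le i) (sq_nonneg l)
    have := hp.1
    gcongr

lemma IsSample.vertexNoise_tail (h : IsSample μ T p u N X) (hp : p ∈ Set.Icc (0 : ℝ) 1)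
    (i : Fin n) {l : ℝ} (hl0 : 0 ≤ l) (hl1 : l ≤ 1) (β : ℝ) :
    μ.real {ω | β < |vertexNoise u (fun e => N e ω) (fun e t => X e t ω) i|}
      ≤ 2 * Real.exp (-(l * β) + T * p * (2 * n * l ^ 2)) := by
  have h1 := h.signed_vertexNoise_tail hp i hl0 hl1 (s := 1) (by simp) β
  have h2 := h.signed_vertexNoise_tail hp i hl0 hl1 (s := -1) (by simp) β
  rw [two_mul]
  refine (measureReal_mono ?_).trans ((measureReal_union_le _ _).trans (add_le_add h1 h2))
  intro ω hω
  simp only [Set.mem_ofPred_eq, Set.mem_union] at hω ⊢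
  rcases lt_abs.1 hω with h | h
  · left; linarith
  · right; linarith

lemma IsSample.cross_tail (h : IsSample μ T p u N X) (hp : p ∈ Set.Icc (0 : ℝ) 1) (hT : 1 ≤ T)
    {A B : Finset (Fin n)} (hAB : A ⊆ B) (hB : 2 * B.card ≤ n) (x : ℝ) :
    μ.real {ω | ∑ e ∈ cross A B, ((observed T (N e ω)).card : ℝ) < x}
      ≤ Real.exp (x - n * p / 4 * A.card) := by
  classical
  have hexp : Real.exp (-1) ≤ 1 + -1 / 2 := by
    have := Real.exp_one_gt_d9
    rw [Real.exp_neg, inv_le_comm₀ (Real.exp_pos 1) (by norm_num)]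
    norm_num
    linarith
  -- A lower tail: each crossing comparison has weight `-1`, and `e^{-1} ≤ 1 - 1/2`. At least
  -- `A.card * n / 2` pairs cross, whence the exponent `n * p / 4 * A.card`.
  have h1 := h.chernoff hp (fun e _ => if e ∈ cross A B then -1 else 0)
    (fun e => if e ∈ cross A B then -1 / 2 else 0) (fun e => by
      split_ifs
      · linarith
      · simp) (-x)
  refine (measureReal_mono ?_).trans (h1.trans (Real.exp_le_exp.2 ?_))
  · intro ω hω
    simp only [Set.mem_ofPred_eq] at hω ⊢
    have h2 : ∑ e, ∑ _t ∈ observed T (N e ω), (if e ∈ cross A B then (-1 : ℝ) else 0)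
        = -∑ e ∈ cross A B, ((observed T (N e ω)).card : ℝ) := by
      rw [← Finset.sum_neg_distrib, ← Finset.univ_inter (cross A B), ← Finset.sum_ite_mem]
      refine Finset.sum_congr rfl fun e _ => ?_
      rw [Finset.univ_inter]
      split_ifs <;> simp
    linarith
  · have hcard : (A.card : ℝ) * (n / 2) ≤ (cross A B).card := by
      have h2 := card_mul_le_card_cross hAB
      have h3 : (A.card : ℝ) * ((n - B.card : ℕ) : ℝ) ≤ (cross A B).card := by exact_mod_cast h2
      have h4 : (n : ℝ) / 2 ≤ ((n - B.card : ℕ) : ℝ) := by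
        rw [Nat.cast_sub (by omega)]
        have : (2 * B.card : ℝ) ≤ n := by exact_mod_cast hB
        linarith
      exact (mul_le_mul_of_nonneg_left h4 (by positivity)).trans h3
    have hT' : (1 : ℝ) ≤ T := by exact_mod_cast hT
    have hp0 := hp.1
    rw [Finset.sum_ite_mem, Finset.univ_inter, Finset.sum_const, nsmul_eq_mul]
    have h5 : p * ((A.card : ℝ) * (n / 2)) ≤ T * p * (cross A B).card :=
      calc _ ≤ p * (cross A B).card := by gcongr
        _ = 1 * p * (cross A B).card := by ring
        _ ≤ _ := by gcongr
    linarith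

/-- The vertex noises are at most `β`, and small vertex sets expand. -/
def IsGood (N : Pair n → ℕ) (X : Pair n → Fin T → ℤˣ) (u : Fin n → ℝ) (β γ ρ : ℝ) : Prop :=
  (∀ i, |vertexNoise u N X i| ≤ β) ∧
    ∀ A B : Finset (Fin n), A ⊆ B → A.Nonempty → 2 * B.card ≤ n →
      (B.card : ℝ) ≤ ρ * A.card → γ * A.card ≤ ∑ e ∈ cross A B, ((observed T (N e)).card : ℝ)

/-- The sum is `(1 + 1 / n) ^ n`. It pays for union bounds over all vertex sets when each set costs
`n ^ (-A.card)`. -/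
lemma sum_inv_pow_card_le (hn : 0 < n) :
    ∑ A : Finset (Fin n), ((n : ℝ)⁻¹) ^ A.card ≤ Real.exp 1 := by
  have h := Fintype.sum_pow_mul_eq_add_pow (Fin n) ((n : ℝ)⁻¹) 1
  simp only [one_pow, mul_one, Fintype.card_fin] at h
  rw [h]
  have hn' : (n : ℝ) ≠ 0 := by positivity
  calc ((n : ℝ)⁻¹ + 1) ^ n ≤ Real.exp ((n : ℝ)⁻¹) ^ n := by
        gcongr
        exact Real.add_one_le_exp _
    _ = Real.exp 1 := by rw [← Real.exp_nat_mul, mul_inv_cancel₀ hn']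

/-- With high probability, the sample is good. -/
theorem IsSample.measureReal_not_isGood_le (h : IsSample μ T p u N X)
    (hp : p ∈ Set.Icc (0 : ℝ) 1) (hT : 1 ≤ T) (hn : 2 ≤ n) (hd : Real.log n ≤ n * p) :
    μ.real {ω | ¬ IsGood (fun e => N e ω) (fun e t => X e t ω) u
        ((2 * T + 3) * Real.sqrt (n * p * Real.log n)) (n * p / 8) (n * p / (32 * Real.log n))}
      ≤ 14 / (n : ℝ) ^ 2 := by
  classical
  have hn0 : (0 : ℝ) < n := by positivity
  have hlog : 0 < Real.log n := Real.log_pos (by exact_mod_cast hn)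
  set L := Real.log n with hL
  set d := (n : ℝ) * p with hdd
  have hd0 : 0 < d := hlog.trans_le hd
  have hexpL : ∀ k : ℕ, Real.exp (-(k * L)) = ((n : ℝ)⁻¹) ^ k := by
    intro k
    rw [Real.exp_neg, Real.exp_nat_mul, hL, Real.exp_log hn0, inv_pow]
  set V : Fin n → Set Ω := fun i => {ω | (2 * T + 3) * Real.sqrt (d * L) <
    |vertexNoise u (fun e => N e ω) (fun e t => X e t ω) i|} with hV
  set S : Finset (Finset (Fin n) × Finset (Fin n)) := Finset.univ.filter fun P =>
    P.1 ⊆ P.2 ∧ P.1.Nonempty ∧ 2 * P.2.card ≤ n ∧ (P.2.card : ℝ) ≤ d / (32 * L) * P.1.card with hS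
  set W : Finset (Fin n) × Finset (Fin n) → Set Ω := fun P =>
    {ω | ∑ e ∈ cross P.1 P.2, ((observed T (N e ω)).card : ℝ) < d / 8 * P.1.card} with hW
  -- The tilt `√(L / d)` turns the exponent into `-(2T + 3)L + 2T L = -3L`; `L ≤ d` keeps it at most
  -- 1.
  have hVle : ∀ i, μ.real (V i) ≤ 2 * ((n : ℝ)⁻¹) ^ 3 := by
    intro i
    have hl1 : Real.sqrt (L / d) ≤ 1 := Real.sqrt_le_one.2 ((div_le_one hd0).2 hd)
    refine (h.vertexNoise_tail hp i (Real.sqrt_nonneg (L / d)) hl1 _).trans ?_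
    rw [← hexpL 3, Real.sq_sqrt (by positivity)]
    refine mul_le_mul_of_nonneg_left (Real.exp_le_exp.2 (le_of_eq ?_)) (by norm_num)
    have h1 : Real.sqrt (L / d) * Real.sqrt (d * L) = L := by
      rw [← Real.sqrt_mul (by positivity)]
      have : L / d * (d * L) = L ^ 2 := by field_simp
      rw [this, Real.sqrt_sq hlog.le]
    have h2 : T * p * (2 * n * (L / d)) = 2 * T * L := by
      have : T * p * (2 * n * (L / d)) = 2 * T * (d * (L / d)) := by rw [hdd]; ring
      rw [this, mul_div_cancel₀ _ hd0.ne']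
    rw [h2]
    push_cast
    linear_combination (-(2 * (T : ℝ) + 3)) * h1
  -- The exponent is `-(d / 8) * P.1.card`. The constant 32 in `ρ` makes `4 * P.2.card * L` at most
  -- this size, which covers the `2 + P.1.card + P.2.card` factors of `1 / n`.
  have hWle : ∀ P ∈ S, μ.real (W P)
      ≤ ((n : ℝ)⁻¹) ^ 2 * (((n : ℝ)⁻¹) ^ P.1.card * ((n : ℝ)⁻¹) ^ P.2.card) := by
    intro P hP
    simp only [hS, Finset.mem_filter, Finset.mem_univ, true_and] at hP
    obtain ⟨h1, h2, h3, h4⟩ := hP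
    refine (h.cross_tail hp hT h1 h3 _).trans ?_
    rw [← pow_add, ← pow_add, ← hexpL]
    refine Real.exp_le_exp.2 ?_
    have h5 : (P.1.card : ℝ) ≤ P.2.card := by exact_mod_cast Finset.card_le_card h1
    have h6 : (1 : ℝ) ≤ P.1.card := by exact_mod_cast h2.card_pos
    have h7 : P.2.card * L ≤ d / 32 * P.1.card := by
      have := mul_le_mul_of_nonneg_right h4 hlog.le
      refine this.trans_eq ?_
      field_simp
    push_cast
    have h8 : (2 + (P.1.card + P.2.card : ℝ)) * L ≤ 4 * (P.2.card * L) := by nlinarith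
    linarith
  have hsub : {ω | ¬ IsGood (fun e => N e ω) (fun e t => X e t ω) u
      ((2 * T + 3) * Real.sqrt (d * L)) (d / 8) (d / (32 * L))}
      ⊆ (⋃ i ∈ (Finset.univ : Finset (Fin n)), V i) ∪ ⋃ P ∈ S, W P := by
    intro ω hω
    simp only [Set.mem_ofPred_eq, IsGood, not_and_or, not_forall, not_le] at hω
    rcases hω with ⟨i, hi⟩ | ⟨A, B, hAB, hA, hB, hρ, hlt⟩
    · left
      simp only [Set.mem_iUnion]
      exact ⟨i, Finset.mem_univ i, hi⟩
    · right
      simp only [Set.mem_iUnion]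
      exact ⟨(A, B), by simp only [hS, Finset.mem_filter, Finset.mem_univ, true_and]
                        exact ⟨hAB, hA, hB, hρ⟩, hlt⟩
  have hVs : μ.real (⋃ i ∈ (Finset.univ : Finset (Fin n)), V i) ≤ 2 * ((n : ℝ)⁻¹) ^ 2 := by
    refine (measureReal_biUnion_finset_le _ _).trans
      ((Finset.sum_le_sum fun i _ => hVle i).trans_eq ?_)
    rw [Finset.sum_const, Finset.card_fin, nsmul_eq_mul]
    field_simp
  have hWs : μ.real (⋃ P ∈ S, W P) ≤ 12 * ((n : ℝ)⁻¹) ^ 2 := by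
    refine (measureReal_biUnion_finset_le _ _).trans ((Finset.sum_le_sum hWle).trans ?_)
    refine (Finset.sum_le_sum_of_subset_of_nonneg (Finset.subset_univ S)
      fun _ _ _ => by positivity).trans ?_
    rw [← Finset.mul_sum, Fintype.sum_prod_type]
    dsimp only
    rw [← Finset.sum_mul_sum, mul_comm]
    refine mul_le_mul_of_nonneg_right ?_ (by positivity)
    have h1 := sum_inv_pow_card_le (n := n) (by omega)
    have h2 := Real.exp_one_lt_d9
    calc _ ≤ Real.exp 1 * Real.exp 1 := mul_le_mul h1 h1 (by positivity) (by positivity)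
      _ ≤ 3 * 3 := by gcongr <;> linarith
      _ ≤ 12 := by norm_num
  calc _ ≤ 2 * ((n : ℝ)⁻¹) ^ 2 + 12 * ((n : ℝ)⁻¹) ^ 2 :=
        (measureReal_mono hsub).trans ((measureReal_union_le _ _).trans (add_le_add hVs hWs))
    _ = 14 / (n : ℝ) ^ 2 := by
        rw [inv_pow]
        ring

/-! ### The rate -/

lemma dynamicRange_nonneg {n : ℕ} (u : Fin n → ℝ) : 0 ≤ dynamicRange u :=
  Real.iSup_nonneg fun _ => abs_nonneg _

lemma abs_gap_le_dynamicRange {n : ℕ} (u : Fin n → ℝ) (e : Pair n) :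
    |gap u e| ≤ dynamicRange u :=
  le_ciSup (f := fun e : Fin n × Fin n => |u e.1 - u e.2|) (Set.finite_range _).bddAbove e.1

/-- A bounded rate bounds its factor that does not depend on the scores. -/
lemma sqrt_mul_log_div_log_le_one {n : ℕ} {p : ℝ} {u : Fin n → ℝ} (hnp : 1 < n * p)
    (hrate : rate p u ≤ 1) :
    Real.sqrt (Real.log n / (n * p)) * (Real.log n / Real.log (n * p)) ≤ 1 := by
  refine le_trans ?_ hrate
  rw [rate, mul_assoc]
  have h1 := Real.log_natCast_nonneg n
  have h2 := Real.log_pos hnp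
  exact le_mul_of_one_le_left (by positivity)
    (Real.one_le_exp (by linarith [dynamicRange_nonneg u]))

lemma one_le_log_div_log {n : ℕ} {p : ℝ} (hp : p ≤ 1) (hnp : 1 < n * p) :
    1 ≤ Real.log n / Real.log (n * p) := by
  rw [one_le_div (Real.log_pos hnp)]
  exact Real.log_le_log (by linarith) (mul_le_of_le_one_right (Nat.cast_nonneg n) hp)

/-- As `p ≤ 1`, the factor `log n / log (n p)` is at least 1, so the square root alone is at most 1.
-/
lemma log_le_of_rate_le_one {n : ℕ} {p : ℝ} {u : Fin n → ℝ} (hp : p ≤ 1) (hnp : 1 < n * p)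
    (hrate : rate p u ≤ 1) : Real.log n ≤ n * p := by
  have h1 := (le_mul_of_one_le_right (Real.sqrt_nonneg _) (one_le_log_div_log hp hnp)).trans
    (sqrt_mul_log_div_log_le_one hnp hrate)
  exact (div_le_one (by linarith)).1 (Real.sqrt_le_one.1 h1)

/-- If `√(l/d) · l / log d ≤ 1`, then `d / l` is at least of order `d^{1/4}`. -/
lemma exp_log_div_four_le {d l : ℝ} (hl : 0 < l) (hd : 128 ^ 4 ≤ d)
    (h : Real.sqrt (l / d) * (l / Real.log d) ≤ 1) :
    Real.exp (Real.log d / 4) ≤ d / (32 * l) := by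
  have hd0 : 0 < d := by linarith
  set y := Real.log d with hy
  have hy0 : 0 < y := Real.log_pos (by linarith)
  set w := Real.exp (y / 4) with hw
  have hw0 : 0 < w := Real.exp_pos _
  have hw4 : w ^ 4 = d := by
    rw [hw, ← Real.exp_nat_mul, ← Real.exp_log hd0]
    congr 1
    push_cast
    ring
  have hw128 : 128 ≤ w := by
    rw [← hw4] at hd
    exact (pow_le_pow_iff_left₀ (by norm_num) hw0.le (by norm_num)).1 hd
  have hyw : y ≤ 4 * w := by
    have := Real.add_one_le_exp (y / 4)
    linarith
  have h1 : l ^ 3 ≤ d * y ^ 2 := by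
    have h2 : (Real.sqrt (l / d) * (l / y)) ^ 2 ≤ 1 := pow_le_one₀ (by positivity) h
    rw [mul_pow, Real.sq_sqrt (by positivity)] at h2
    have h3 : l / d * (l / y) ^ 2 = l ^ 3 / (d * y ^ 2) := by field_simp
    rwa [h3, div_le_one (by positivity)] at h2
  have h2 : y ^ 2 ≤ 16 * w ^ 2 := by
    have := pow_le_pow_left₀ hy0.le hyw 2
    linarith [mul_pow 4 w 2]
  -- With `w = d^{1/4}`, the hypothesis gives `l ^ 3 ≤ 16 * w ^ 6`; the threshold 128 is chosen so
  -- that `32 ^ 3 * 16 ≤ w ^ 3`.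
  have h3 : (32 * l) ^ 3 ≤ (w ^ 3) ^ 3 :=
    calc (32 * l) ^ 3 = 32768 * l ^ 3 := by ring
      _ ≤ 32768 * (w ^ 4 * (16 * w ^ 2)) := by
        rw [hw4]
        have : d * y ^ 2 ≤ d * (16 * w ^ 2) := by gcongr
        linarith
      _ = 524288 * w ^ 6 := by ring
      _ ≤ w ^ 3 * w ^ 6 := by
        have : (128 : ℝ) ^ 3 ≤ w ^ 3 := by gcongr
        gcongr
        linarith
      _ = (w ^ 3) ^ 3 := by ring
  have h4 : 32 * l ≤ w ^ 3 :=
    (pow_le_pow_iff_left₀ (by positivity) (by positivity) (by norm_num)).1 h3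
  rw [le_div_iff₀ (by positivity), ← hw4]
  calc w * (32 * l) ≤ w * w ^ 3 := by gcongr
    _ = w ^ 4 := by ring

/-- For good data, the maximum likelihood estimator exists, is unique, and has the claimed
accuracy. -/
theorem IsGood.exists_isUniqueMLE {n T : ℕ} {p : ℝ} (hp : p ≤ 1) {u : Fin n → ℝ}
    (hu : Anchored u) (hn : (128 : ℝ) ^ 4 ≤ Real.log n) (hnp : 1 < n * p)
    (hrate : 100 * (2 * T + 3) * rate p u ≤ 1) {N : Pair n → ℕ} {X : Pair n → Fin T → ℤˣ}
    (h : IsGood N X u ((2 * T + 3) * Real.sqrt (n * p * Real.log n)) (n * p / 8)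
      (n * p / (32 * Real.log n))) :
    ∃ v : Fin n → ℝ, IsUniqueMLE N X v ∧ ‖v - u‖ ≤ 1000 * (2 * T + 3) * rate p u := by
  have hn0 : 0 < n := by
    rcases Nat.eq_zero_or_pos n with rfl | h0
    · norm_num at hn
    · exact h0
  have hnR : (0 : ℝ) < n := by exact_mod_cast hn0
  have hT0 : (0 : ℝ) ≤ T := by positivity
  have hly := one_le_log_div_log hp hnp
  have hy0 := Real.log_pos hnp
  have hM0 := dynamicRange_nonneg u
  have hl0 : 0 < Real.log n := by linarith
  have hd0 : 0 < n * p := by linarith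
  have hr0 : 0 ≤ rate p u := by unfold rate; positivity
  have hr1 : rate p u ≤ 1 := (le_mul_of_one_le_left hr0 (by linarith)).trans hrate
  have hsr := sqrt_mul_log_div_log_le_one hnp hr1
  have hld := log_le_of_rate_le_one hp hnp hr1
  have hw := exp_log_div_four_le hl0 (hn.trans hld) hsr
  have hrate_eq : rate p u = Real.exp (2 * dynamicRange u) * Real.sqrt (Real.log n / (n * p)) *
    (Real.log n / Real.log (n * p)) := rfl
  set l := Real.log n with hl
  set d := (n : ℝ) * p with hd
  set M := dynamicRange u with hM
  set y := Real.log d with hy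
  set s := Real.sqrt (l / d) with hs
  have hs0 : 0 < s := Real.sqrt_pos.2 (by positivity)
  set c : ℝ := 100 * (2 * T + 3) with hc
  have hc0 : 0 < c := by positivity
  set g := c * (Real.exp M * s) with hg
  -- Since `ρ ≥ e^{y/4}`, this many steps give `ρ ^ K ≥ n`; rounding up is absorbed by `l / y ≥ 1`.
  set K := ⌈4 * l / y⌉₊ with hKdef
  have hK1 : 4 * l / y ≤ K := Nat.le_ceil _
  have hK2 : (K : ℝ) ≤ 5 * (l / y) := by
    have := (Nat.ceil_lt_add_one (by positivity : 0 ≤ 4 * l / y)).le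
    have h2 : 4 * l / y = 4 * (l / y) := by ring
    linarith
  -- Only one factor `e^M` is spent; the rate offers `e^{2M}`.
  have hgle : Real.exp M * s * (l / y) ≤ rate p u := by
    rw [hrate_eq]
    gcongr
    linarith
  have hg1 : g ≤ 1 := by
    refine le_trans ?_ hrate
    refine mul_le_mul_of_nonneg_left (le_trans ?_ hgle) hc0.le
    exact le_mul_of_one_le_right (by positivity) hly
  have hKn : (n : ℝ) < 2 * (d / (32 * l)) ^ K := by
    have h1 : (n : ℝ) ≤ (d / (32 * l)) ^ K :=
      calc (n : ℝ) = Real.exp l := (Real.exp_log hnR).symm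
        _ ≤ Real.exp (K * (y / 4)) := by
          rw [div_le_iff₀ hy0] at hK1
          exact Real.exp_le_exp.2 (by linarith)
        _ = Real.exp (y / 4) ^ K := Real.exp_nat_mul _ _
        _ ≤ _ := by gcongr
    linarith
  have hsd : s * d = Real.sqrt (d * l) := by
    rw [eq_comm, Real.sqrt_eq_iff_mul_self_eq (by positivity) (by positivity)]
    have : s * s = l / d := Real.mul_self_sqrt (by positivity)
    calc d * l = s * s * d * d := by rw [this]; field_simp
      _ = s * d * (s * d) := by ring
  -- The factor 100 in `c` is used here, through `100 / 32 > e`.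
  have hβγ : (2 * T + 3) * Real.sqrt (d * l) < Real.exp (-M - 1) / 4 * g * (d / 8) := by
    have h1 : Real.exp (-M - 1) * Real.exp M = (Real.exp 1)⁻¹ := by
      rw [← Real.exp_add, ← Real.exp_neg]
      ring_nf
    have h2 : Real.exp (-M - 1) / 4 * g * (d / 8)
        = (2 * T + 3) * Real.sqrt (d * l) * (100 / 32 * (Real.exp 1)⁻¹) := by
      rw [← h1, ← hsd, hg, hc]
      ring
    rw [h2]
    refine lt_mul_of_one_lt_right (by positivity) ?_
    have := Real.exp_one_lt_d9
    rw [← div_eq_mul_inv, one_lt_div (Real.exp_pos 1)]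
    linarith
  obtain ⟨v, hv1, hv2, hv3, hv4⟩ := exists_unique_maximizer hn0 hu
    (Y := fun e => wins (N e) (X e)) (m := fun e => ((observed T (N e)).card : ℝ))
    (fun e => Nat.cast_nonneg _) (abs_gap_le_dynamicRange u) (by positivity : 0 < g) hg1
    ((Real.one_le_exp (by positivity)).trans hw) (by positivity) hβγ hKn h.1 h.2
  refine ⟨v, ⟨⟨hv1, fun w _ => ?_⟩, fun w hw => ?_⟩, hv4.trans ?_⟩
  · rw [logLik_eq_objective]
    exact hv2 w
  · refine hv3 w hw.1 ?_
    have := hw.2 v hv1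
    rwa [logLik_eq_objective] at this
  · calc 2 * (K * g) ≤ 2 * (5 * (l / y) * g) := by gcongr
      _ = 10 * c * (Real.exp M * s * (l / y)) := by rw [hg]; ring
      _ ≤ 10 * c * rate p u := by gcongr
      _ = 1000 * (2 * T + 3) * rate p u := by rw [hc]; ring

end BradleyTerry

/-! ### Consistency with high probability and almost surely -/

theorem mainTheorem5 {Ω : Type*} [MeasurableSpace Ω] (μ : Measure Ω) [IsProbabilityMeasure μ]
    (T : ℕ) (hT : 1 ≤ T)
    (p : ℕ → ℝ) (hp : ∀ n, p n ∈ Set.Icc (0 : ℝ) 1)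
    (hnp : ∀ᶠ n : ℕ in atTop, 1 < (n : ℝ) * p n)
    (u : (n : ℕ) → Fin n → ℝ) (hu : ∀ n, BradleyTerry.Anchored (u n))
    (N : (n : ℕ) → BradleyTerry.Pair n → Ω → ℕ)
    (X : (n : ℕ) → BradleyTerry.Pair n → Fin T → Ω → ℤˣ)
    (hmodel : ∀ n, BradleyTerry.IsSample μ T (p n) (u n) (N n) (X n))
    (hrate : Tendsto (fun n : ℕ => BradleyTerry.rate (p n) (u n)) atTop (𝓝 0)) :
    (∃ C : ℝ, 0 < C ∧ ∀ᶠ n : ℕ in atTop,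
      1 - 14 / (n : ℝ) ^ 2 ≤ μ.real {ω | ∃ uhat : Fin n → ℝ,
        BradleyTerry.IsUniqueMLE (fun e => N n e ω) (fun e t => X n e t ω) uhat ∧
        ‖uhat - u n‖ ≤ C * BradleyTerry.rate (p n) (u n)}) ∧
    (∀ᵐ ω ∂μ, ∃ uhat : (n : ℕ) → Fin n → ℝ,
      (∀ᶠ n : ℕ in atTop,
        BradleyTerry.IsUniqueMLE (fun e => N n e ω) (fun e t => X n e t ω) (uhat n)) ∧
      Tendsto (fun n : ℕ => ‖uhat n - u n‖) atTop (𝓝 0)) := by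
  have hlogn : ∀ᶠ n : ℕ in atTop, (128 : ℝ) ^ 4 ≤ Real.log n :=
    (Real.tendsto_log_atTop.comp tendsto_natCast_atTop_atTop).eventually_ge_atTop _
  have hsmall : ∀ᶠ n : ℕ in atTop,
      100 * (2 * (T : ℝ) + 3) * BradleyTerry.rate (p n) (u n) ≤ 1 := by
    have := hrate.const_mul (100 * (2 * (T : ℝ) + 3))
    rw [mul_zero] at this
    exact (this.eventually_lt_const one_pos).mono fun _ h => h.le
  have hone : ∀ᶠ n : ℕ in atTop, BradleyTerry.rate (p n) (u n) ≤ 1 :=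
    (hrate.eventually_lt_const one_pos).mono fun _ h => h.le
  set G : ℕ → Set Ω := fun n => {ω | ∃ uhat : Fin n → ℝ,
    BradleyTerry.IsUniqueMLE (fun e => N n e ω) (fun e t => X n e t ω) uhat ∧
    ‖uhat - u n‖ ≤ 1000 * (2 * T + 3) * BradleyTerry.rate (p n) (u n)} with hG
  have hbad : ∀ᶠ n : ℕ in atTop, μ.real (G n)ᶜ ≤ 14 / (n : ℝ) ^ 2 := by
    filter_upwards [hlogn, hsmall, hone, hnp, eventually_ge_atTop 2] with n h1 h2 h3 h4 h5
    refine (measureReal_mono ?_).trans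
      ((hmodel n).measureReal_not_isGood_le (hp n) hT h5
        (BradleyTerry.log_le_of_rate_le_one (hp n).2 h4 h3))
    intro ω hω hgood
    exact hω (hgood.exists_isUniqueMLE (hp n).2 (hu n) h1 h4 h2)
  refine ⟨⟨1000 * (2 * T + 3), by positivity, ?_⟩, ?_⟩
  · filter_upwards [hbad] with n hn
    -- Subadditivity suffices, so measurability of `G n` is not needed.
    have h1 : μ.real Set.univ ≤ μ.real (G n) + μ.real (G n)ᶜ := by
      rw [← Set.union_compl_self (G n)]
      exact measureReal_union_le _ _
    rw [probReal_univ] at h1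
    change _ ≤ μ.real (G n)
    linarith
  · obtain ⟨n₀, hn₀⟩ := eventually_atTop.1 hbad
    -- The summable half of Borel–Cantelli, which needs no independence across `n`.
    have hsum : ∑' n, μ (G (n + n₀))ᶜ ≠ ⊤ := by
      have hs : Summable fun n : ℕ => 14 / ((n + n₀ : ℕ) : ℝ) ^ 2 := by
        have h1 := (Real.summable_one_div_nat_pow (p := 2)).2 one_lt_two
        have h2 := (summable_nat_add_iff n₀).2 (h1.mul_left 14)
        simpa [div_eq_mul_inv] using h2
      refine ne_top_of_le_ne_top hs.tsum_ofReal_ne_top (ENNReal.tsum_le_tsum fun n => ?_)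
      rw [← ofReal_measureReal]
      exact ENNReal.ofReal_le_ofReal (hn₀ _ (by omega))
    filter_upwards [ae_eventually_notMem hsum] with ω hω
    have hev : ∀ᶠ n in atTop, ω ∈ G n := by
      rw [← map_add_atTop_eq_nat n₀, eventually_map]
      exact hω.mono fun n hn => not_not.1 hn
    classical
    refine ⟨fun n => if h : ω ∈ G n then h.choose else 0, ?_, ?_⟩
    · filter_upwards [hev] with n hn
      rw [dif_pos hn]
      exact hn.choose_spec.1
    · refine squeeze_zero' (Eventually.of_forall fun _ => norm_nonneg _) ?_
        (by simpa using hrate.const_mul (1000 * (2 * (T : ℝ) + 3)))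
      filter_upwards [hev] with n hn
      rw [dif_pos hn]
      exact hn.choose_spec.2
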